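/- **Model.** Let $n\ge 0$. Nodes have unique identifiers in $\{1,\dots,n\}$. A synchronous network starts in round $0$ as an arbitrary graph $G_0$ on some of these nodes (for instance the empty graph), and at the beginning of each later round an arbitrary finite number of topology changes occur, one after the other; $G_i$ is the graph in round $i$. A topology change is the insertion of an edge, the deletion of an edge, the insertion of a node together with edges to present nodes, or the (abrupt) deletion of a node together with its edges; each counts as one change. A deleted node may be inserted again later, in a fresh state. In each round every node knows its identifier, $n$, its current incident edges and the round number modulo $15n$, and it receives indications of the changes that occurred to its incident edges (saying whether an edge or a neighbor was inserted or deleted). It then performs a local computation, may send a message to each of its neighbors in $G_i$, receives the messages of its neighbors, and updates its state. Each node stores its own label, a color; in $G_0$ the colors are prescribed, and a newly inserted node knows initially only its identifier, $n$ and the above. Let $\Delta_i$ be the largest degree of a node in any of $G_0,\dots,G_i$. In round $i$, the star of a node $v$ is *consistent* if the color of $v$ lies in $\{1,\dots,\Delta_i+1\}$ and differs from the colors of all neighbors of $v$ in $G_i$. Let $\mathrm{incorrect}(i)$ be the number of rounds $j\le i$ in which some star is inconsistent, before or after the communication of round $j$, and let $\mathrm{changes}(i)$ be the number of topology changes that occurred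 until round $i$. **Theorem.** There are absolute constants $b,k$ and a deterministic distributed algorithm (one for each $n$, not depending on the degrees) with messages of at most $b(\lfloor\log_2 n\rfloor+1)=O(\log n)$ bits (read as $b$ bits for $n=0$) such that for every $n$, every such sequence of node and edge insertions and deletions, and every initial coloring of $G_0$ for which all stars are consistent in $G_0$, the following hold. 1. (Fixing.) If the star of a node is inconsistent at the end of some round, then it is consistent at the end of some later round, or a later topology change occurs in this star. 2. ($O(1)$ amortized rounds.) For every $i\ge 0$, $\mathrm{incorrect}(i)\le k\cdot\mathrm{changes}(i)$. That is, there is a deterministic dynamic distributed fixing algorithm for $(\Delta+1)$-coloring which handles edge and node insertions and deletions in $O(1)$ amortized rounds. -/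

import Mathlib

namespace DynColoring

/-! ### The environment: networks and topology changes -/

/-- A network on identifiers `Fin n`: the nodes currently in the system and the edges. -/
structure Network (n : ℕ) where
  nodes : Set (Fin n)
  graph : SimpleGraph (Fin n)

/-- A single topology change. Inserting a node comes with its edges to present nodes and counts as
one change; so does deleting a node together with all its edges. -/
inductive Change (n : ℕ) where
  | edgeInsert (u v : Fin n)
  | edgeDelete (u v : Fin n)
  | nodeInsert (v : Fin n) (N : Set (Fin n))
  | nodeDelete (v : Fin n)

/-- When a change can occur in a network. -/
def Change.Legal {n : ℕ} (G : Network n) : Change n → Prop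
  | .edgeInsert u v => u ∈ G.nodes ∧ v ∈ G.nodes ∧ u ≠ v ∧ ¬ G.graph.Adj u v
  | .edgeDelete u v => G.graph.Adj u v
  | .nodeInsert v N => v ∉ G.nodes ∧ N ⊆ G.nodes
  | .nodeDelete v => v ∈ G.nodes

/-- The network after a change. -/
def Network.apply {n : ℕ} (G : Network n) : Change n → Network n
  | .edgeInsert u v => ⟨G.nodes, G.graph ⊔ SimpleGraph.edge u v⟩
  | .edgeDelete u v => ⟨G.nodes, G.graph.deleteEdges {s(u, v)}⟩
  | .nodeInsert v N => ⟨insert v G.nodes, G.graph ⊔ SimpleGraph.fromRel fun a b => a = v ∧ b ∈ N⟩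
  | .nodeDelete v => ⟨G.nodes \ {v}, G.graph.deleteEdges (G.graph.incidenceSet v)⟩

/-- The network after a sequence of changes. -/
def Network.applyAll {n : ℕ} (G : Network n) (cs : List (Change n)) : Network n :=
  cs.foldl Network.apply G

/-- Every change of the sequence is legal when it occurs. -/
def Network.LegalAll {n : ℕ} : Network n → List (Change n) → Prop
  | _, [] => True
  | G, c :: cs => c.Legal G ∧ (G.apply c).LegalAll cs

/-- The networks that arise from `G₀` by the batches of changes `F 0`, `F 1`, … -/
def Network.evolve {n : ℕ} (G₀ : Network n) (F : ℕ → List (Change n)) : ℕ → Network n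
  | 0 => G₀
  | i + 1 => (G₀.evolve F i).applyAll (F i)

/-- A dynamic network: an arbitrary initial graph, and for every `i` the finitely many (possibly
no) changes that occur at the beginning of round `i + 1`. There is no other restriction. -/
structure DynamicNetwork (n : ℕ) where
  initial : Network n
  initial_edges : ∀ u v, initial.graph.Adj u v → u ∈ initial.nodes
  changes : ℕ → List (Change n)
  legal : ∀ i, (initial.evolve changes i).LegalAll (changes i)

/-- `D.net i` is the graph in which round `i` takes place. -/
def DynamicNetwork.net {n : ℕ} (D : DynamicNetwork n) : ℕ → Network n :=
  D.initial.evolve D.changes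

open Classical in
/-- The largest node degree that has occurred in rounds `0, …, i`. -/
noncomputable def DynamicNetwork.maxDegree {n : ℕ} (D : DynamicNetwork n) (i : ℕ) : ℕ :=
  (Finset.range (i + 1)).sup fun j => (D.net j).graph.maxDegree

/-- The number of topology changes that have occurred until round `i`. -/
def DynamicNetwork.numChanges {n : ℕ} (D : DynamicNetwork n) (i : ℕ) : ℕ :=
  ∑ j ∈ Finset.range i, (D.changes j).length

/-! ### What a node is told about topology changes -/

/-- What a node may learn about a change of one of its edges: that the edge to `u` was inserted or
deleted, or that its neighbor `u` was inserted into or deleted from the system. -/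
inductive Indication (n : ℕ) where
  | edgeInserted (u : Fin n)
  | edgeDeleted (u : Fin n)
  | nodeInserted (u : Fin n)
  | nodeDeleted (u : Fin n)

/-- `Notified G c w x`: if the change `c` occurs in `G`, then the node `w` gets indication `x`. -/
inductive Notified {n : ℕ} (G : Network n) : Change n → Fin n → Indication n → Prop
  | edgeInsert_left (u v : Fin n) : Notified G (.edgeInsert u v) u (.edgeInserted v)
  | edgeInsert_right (u v : Fin n) : Notified G (.edgeInsert u v) v (.edgeInserted u)
  | edgeDelete_left (u v : Fin n) : Notified G (.edgeDelete u v) u (.edgeDeleted v)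
  | edgeDelete_right (u v : Fin n) : Notified G (.edgeDelete u v) v (.edgeDeleted u)
  | nodeInsert (v w : Fin n) (N : Set (Fin n)) (h : w ∈ N) :
      Notified G (.nodeInsert v N) w (.nodeInserted v)
  | nodeDelete (v w : Fin n) (h : G.graph.Adj v w) :
      Notified G (.nodeDelete v) w (.nodeDeleted v)

/-- The change `c`, occurring in `G`, affects the star centered at `w`. -/
def Touches {n : ℕ} (G : Network n) (c : Change n) (w : Fin n) : Prop :=
  (∃ x, Notified G c w x) ∨ (∃ N, c = .nodeInsert w N) ∨ c = .nodeDelete w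

/-- Some change of the sequence, started in the given network, affects the star of `w`. -/
def TouchesAny {n : ℕ} : Network n → List (Change n) → Fin n → Prop
  | _, [], _ => False
  | G, c :: cs, w => Touches G c w ∨ TouchesAny (G.apply c) cs w

/-! ### Distributed algorithms and their executions -/

/-- A deterministic synchronous message-passing algorithm for networks on `Fin n` in which every
node maintains a color.

* `start v c` is the state of a node `v` of the initial graph, with prescribed color `c`;
* `join v` is the state of a node `v` that has just been inserted;
* `update t N I s` is the local computation at the beginning of a round, where `t` is the time
  known to the node, `N` its current set of neighbors, and `I` the indications it has received;
* `send s u` is the message (a bit string) that is then sent to the neighbor `u`;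
* `receive s m` is the computation at the end of the round, where `m u` is the message received
  from `u`, and `none` if `u` is not a neighbor. -/
structure Algorithm (n : ℕ) where
  State : Type
  start : Fin n → ℕ → State
  join : Fin n → State
  update : ℕ → Set (Fin n) → Set (Indication n) → State → State
  send : State → Fin n → List Bool
  receive : State → (Fin n → Option (List Bool)) → State
  color : State → ℕ
  color_start : ∀ v c, color (start v c) = c

/-- All messages have at most `B` bits. -/
def Algorithm.MessagesAtMost {n : ℕ} (A : Algorithm n) (B : ℕ) : Prop :=
  ∀ s u, (A.send s u).length ≤ B

/-- The local state of each node, and the indications that have reached it since the last round.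
(The values at identifiers that are not in the system play no role: they have no edges, and a
node that is inserted starts afresh.) -/
structure Locals {n : ℕ} (A : Algorithm n) where
  state : Fin n → A.State
  pending : Fin n → Set (Indication n)

open Classical in
/-- The effect of a change on the local data of the nodes. -/
noncomputable def Locals.after {n : ℕ} {A : Algorithm n} (L : Locals A) (G : Network n)
    (c : Change n) : Locals A where
  state w := if ∃ N, c = .nodeInsert w N then A.join w else L.state w
  pending w := if ∃ N, c = .nodeInsert w N then ∅ else L.pending w ∪ {x | Notified G c w x}

/-- The effect of a sequence of changes on the local data of the nodes. -/
noncomputable def Locals.afterAll {n : ℕ} {A : Algorithm n} :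
    Locals A → Network n → List (Change n) → Locals A
  | L, _, [] => L
  | L, G, c :: cs => (L.after G c).afterAll (G.apply c) cs

/-- The states in round `t` after the local computation and before the communication. All that
a node knows of the time is the round number modulo `15 * n`. -/
def Locals.updated {n : ℕ} {A : Algorithm n} (L : Locals A) (G : Network n) (t : ℕ) :
    Fin n → A.State :=
  fun v => A.update (t % (15 * n)) (G.graph.neighborSet v) (L.pending v) (L.state v)

open Classical in
/-- One communication round: the states at the end of the round. -/
noncomputable def communicate {n : ℕ} (A : Algorithm n) (G : Network n) (s : Fin n → A.State) :
    Fin n → A.State :=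
  fun v => A.receive (s v) fun u => if G.graph.Adj u v then some (A.send (s u) v) else none

/-- The local data at the beginning of round `i`, after the topology changes, in the execution
of `A` on the dynamic network `D` from the initial coloring `c₀`. -/
noncomputable def locals {n : ℕ} (A : Algorithm n) (D : DynamicNetwork n) (c₀ : Fin n → ℕ) :
    ℕ → Locals A
  | 0 => ⟨fun v => A.start v (c₀ v), fun _ => ∅⟩
  | i + 1 => Locals.afterAll
      ⟨communicate A (D.net i) ((locals A D c₀ i).updated (D.net i) i), fun _ => ∅⟩
      (D.net i) (D.changes i)

/-- The colors in round `i` before the communication. -/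
noncomputable def colorBefore {n : ℕ} (A : Algorithm n) (D : DynamicNetwork n) (c₀ : Fin n → ℕ)
    (i : ℕ) (v : Fin n) : ℕ :=
  A.color ((locals A D c₀ i).updated (D.net i) i v)

/-- The colors at the end of round `i`. -/
noncomputable def colorAfter {n : ℕ} (A : Algorithm n) (D : DynamicNetwork n) (c₀ : Fin n → ℕ)
    (i : ℕ) (v : Fin n) : ℕ :=
  A.color (communicate A (D.net i) ((locals A D c₀ i).updated (D.net i) i) v)

/-! ### Consistency and complexity -/

/-- The star centered at `v` is consistent for the problem of coloring with colors `1, …, q`. -/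
def StarConsistent {n : ℕ} (G : Network n) (q : ℕ) (col : Fin n → ℕ) (v : Fin n) : Prop :=
  1 ≤ col v ∧ col v ≤ q ∧ ∀ u, G.graph.Adj v u → col u ≠ col v

/-- All stars are consistent: `col` is a proper coloring of the network by `1, …, q`. -/
def Consistent {n : ℕ} (G : Network n) (q : ℕ) (col : Fin n → ℕ) : Prop :=
  ∀ v ∈ G.nodes, StarConsistent G q col v

/-- In round `i` there is an inconsistent star, before or after the communication. -/
def IncorrectRound {n : ℕ} (A : Algorithm n) (D : DynamicNetwork n) (c₀ : Fin n → ℕ) (i : ℕ) :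
    Prop :=
  ¬ Consistent (D.net i) (D.maxDegree i + 1) (colorBefore A D c₀ i) ∨
  ¬ Consistent (D.net i) (D.maxDegree i + 1) (colorAfter A D c₀ i)

/-- The number of incorrect rounds until round `i`. -/
noncomputable def numIncorrect {n : ℕ} (A : Algorithm n) (D : DynamicNetwork n) (c₀ : Fin n → ℕ)
    (i : ℕ) : ℕ :=
  {j | j ≤ i ∧ IncorrectRound A D c₀ j}.ncard

/-- Every fixing process ends: if the star of a node `v` is inconsistent at the end of a round,
then in some later round it is consistent, or a topology change occurs in this star. -/
def Fixes {n : ℕ} (A : Algorithm n) (D : DynamicNetwork n) (c₀ : Fin n → ℕ) : Prop :=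
  ∀ i, ∀ v ∈ (D.net i).nodes,
    ¬ StarConsistent (D.net i) (D.maxDegree i + 1) (colorAfter A D c₀ i) v →
    ∃ j ≥ i, TouchesAny (D.net j) (D.changes j) v ∨
      StarConsistent (D.net j) (D.maxDegree j + 1) (colorAfter A D c₀ j) v

/-- Amortized round complexity at most `k`: until every round, there have been at most `k` times
as many incorrect rounds as topology changes. -/
def AmortizedRounds {n : ℕ} (A : Algorithm n) (D : DynamicNetwork n) (c₀ : Fin n → ℕ) (k : ℕ) :
    Prop :=
  ∀ i, numIncorrect A D c₀ i ≤ k * D.numChanges i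

end DynColoring

namespace DynColoring

/-! ### Binary encodings -/

/-! The potential is the number of needy nodes: those that are flagged, have color 0 (never a legal
color), or share a color with a neighbor.

A communication round removes from the needy set exactly the recolored nodes
(`WellFormed.needy_communicate`). These are the flagged nodes of least rank among their flagged
neighbors, so no two are adjacent and their new colors cannot clash. Afterwards the needy nodes are
exactly the flagged ones. A topology change makes at most two further nodes needy
(`needy_apply_subset`).

An incorrect round starts with a needy node. If no change occurred just before it, that node is
already flagged, hence some node is recolored and the potential drops; otherwise a change pays for
the round. Each change therefore pays 2 + 1 = 3, which gives the amortized bound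
(`ncard_needy_succ`).

This bound would hold for any injective ranking. The ranks rotate with the clock for the sake of
fixing: every node has rank 0 once in `n` rounds and is then recolored if flagged, whatever happens
around it. -/

lemma foldr_bit_bits (m : ℕ) : m.bits.foldr Nat.bit 0 = m := by
  induction m using Nat.binaryRec' with
  | zero => simp
  | bit b m h ih => rw [Nat.bits_append_bit _ _ h, List.foldr_cons, ih]

lemma bits_injective : Function.Injective Nat.bits := fun a b h => by
  rw [← foldr_bit_bits a, h, foldr_bit_bits]

lemma length_bits_le {m n : ℕ} (h : m ≤ n) : m.bits.length ≤ Nat.log 2 n + 1 := by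
  rw [Nat.size_eq_bits_len, Nat.size_le]
  exact h.trans_lt (Nat.lt_pow_succ_log_self (by norm_num) n)

/-! ### The algorithm -/

/-- The state of a node: its identifier, its color, the time of the current round, and whether it
waits for being recolored. -/
structure NodeState (n : ℕ) where
  id : Fin n
  color : ℕ
  time : ℕ
  flag : Bool

/-- The number of rounds, from time `t` on, until it is the turn of the node `v`. Nodes of lower
rank are recolored first. -/
def rank {n : ℕ} (t : ℕ) (v : Fin n) : ℤ := ((v : ℤ) - t) % n

lemma rank_nonneg {n : ℕ} (t : ℕ) (v : Fin n) : 0 ≤ rank t v :=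
  Int.emod_nonneg _ (by have := v.pos; omega)

lemma rank_injective {n : ℕ} (t : ℕ) : Function.Injective (rank t : Fin n → ℤ) := by
  intro v w h
  have h₁ : (v : ℤ) ≡ w [ZMOD n] := by
    simpa using Int.ModEq.add_right (t : ℤ) (show (v : ℤ) - t ≡ w - t [ZMOD n] from h)
  have h₂ : (v : ℤ) % n = w % n := h₁
  rw [Int.emod_eq_of_lt (by positivity) (by exact_mod_cast v.2),
    Int.emod_eq_of_lt (by positivity) (by exact_mod_cast w.2)] at h₂
  exact Fin.ext (by exact_mod_cast h₂)

/-- Since `n` divides `15 * n`, the reduced clock still determines the time modulo `n`, which is all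
that the rank uses. -/
lemma rank_eq_zero {n : ℕ} (v : Fin n) (m : ℕ) : rank ((v + m * n) % (15 * n)) v = 0 := by
  unfold rank
  refine Int.emod_eq_zero_of_dvd ?_
  rw [Int.natCast_mod, ← Int.modEq_iff_dvd]
  have h : ((v + m * n : ℕ) : ℤ) % ((15 * n : ℕ) : ℤ) ≡ ((v + m * n : ℕ) : ℤ) [ZMOD n] :=
    (Int.mod_modEq _ _).of_dvd ⟨15, by push_cast; ring⟩
  refine h.trans ?_
  push_cast
  simp [Int.ModEq]

/-- A node that has received the messages `m` is entitled to recolor itself. -/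
def MayRecolor {n : ℕ} (s : NodeState n) (m : Fin n → Option (List Bool)) : Prop :=
  s.flag = true ∧ ∀ u x, m u = some (true :: x) → rank s.time s.id < rank s.time u

/-- The color `c` is reported by some neighbor. -/
def Reported {n : ℕ} (m : Fin n → Option (List Bool)) (c : ℕ) : Prop :=
  ∃ u b, m u = some (b :: c.bits)

open Classical in
/-- In every round each node tells its neighbors its color and whether it is flagged. A flagged node
whose rank is lower than those of all its flagged neighbors takes the first color that is not
used by a neighbor; the other nodes become flagged if they see a conflict. -/
@[reducible] noncomputable def coloringAlgorithm (n : ℕ) : Algorithm n where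
  State := NodeState n
  start v c := ⟨v, c, 0, false⟩
  join v := ⟨v, 0, 0, true⟩
  update t _ _ s := ⟨s.id, s.color, t, s.flag⟩
  -- The truncation bounds the message length for every state, reachable or not; in executions
  -- colors never exceed `n`, so nothing is lost.
  send s _ := s.flag :: (min s.color n).bits
  receive s m :=
    if MayRecolor s m then ⟨s.id, sInf {c | 1 ≤ c ∧ ¬ Reported m c}, s.time, false⟩
    else ⟨s.id, s.color, s.time, decide (s.flag = true ∨ s.color = 0 ∨ Reported m s.color)⟩
  color s := s.color
  color_start _ _ := rfl

lemma coloringAlgorithm_messagesAtMost (n : ℕ) :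
    (coloringAlgorithm n).MessagesAtMost (2 * (Nat.log 2 n + 1)) := by
  intro s _
  have := length_bits_le (min_le_right s.color n)
  simp only [List.length_cons]
  omega

/-! ### The effect of the communication -/

section Communication

variable {n : ℕ} (G : Network n) (s : Fin n → NodeState n)

/-- The nodes that are flagged, uncolored, or in conflict with a neighbor. -/
def needy : Set (Fin n) :=
  {v | v ∈ G.nodes ∧
    ((s v).flag = true ∨ (s v).color = 0 ∨ ∃ u, G.graph.Adj v u ∧ (s u).color = (s v).color)}

/-- The nodes that are recolored in a communication round. -/
def recolored (t : ℕ) : Set (Fin n) :=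
  {v | v ∈ G.nodes ∧ (s v).flag = true ∧
    ∀ u, G.graph.Adj v u → (s u).flag = true → rank t v < rank t u}

/-- All edges of the network are between nodes that are present. -/
def Network.Closed (G : Network n) : Prop := ∀ u v, G.graph.Adj u v → u ∈ G.nodes

/-- The states are those of nodes in a common round whose colors fit into messages. -/
structure WellFormed (t : ℕ) : Prop where
  closed : G.Closed
  id : ∀ v ∈ G.nodes, (s v).id = v
  time : ∀ v, (s v).time = t
  color_le : ∀ v ∈ G.nodes, (s v).color ≤ n

open Classical in
/-- The messages received by `v`. -/
noncomputable def inbox (v : Fin n) : Fin n → Option (List Bool) :=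
  fun u => if G.graph.Adj u v then some ((coloringAlgorithm n).send (s u) v) else none

variable {G s} {t : ℕ} (h : WellFormed G s t)
include h

/-- Colors of present nodes are at most `n`, so truncation leaves them intact, and the binary
encoding is injective. -/
lemma WellFormed.reported_iff {v : Fin n} {c : ℕ} :
    Reported (inbox G s v) c ↔ ∃ u, G.graph.Adj v u ∧ (s u).color = c := by
  have key : ∀ u, G.graph.Adj v u → min (s u).color n = (s u).color := fun u hu =>
    min_eq_left (h.color_le u (h.closed u v hu.symm))
  constructor
  · rintro ⟨u, b, hu⟩
    by_cases hadj : G.graph.Adj v u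
    · refine ⟨u, hadj, bits_injective ?_⟩
      simp only [inbox, hadj.symm, if_true, Option.some.injEq, List.cons.injEq, key u hadj] at hu
      exact hu.2
    · simp [inbox, G.graph.adj_comm u v, hadj] at hu
  · rintro ⟨u, hadj, rfl⟩
    exact ⟨u, (s u).flag, by simp [inbox, hadj.symm, key u hadj]⟩

lemma WellFormed.mayRecolor_iff {v : Fin n} (hv : v ∈ G.nodes) :
    MayRecolor (s v) (inbox G s v) ↔ v ∈ recolored G s t := by
  unfold MayRecolor recolored
  rw [h.id v hv, h.time v]
  simp only [Set.mem_ofPred_eq, hv, true_and]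
  refine and_congr_right fun _ => forall_congr' fun u => ?_
  by_cases hadj : G.graph.Adj v u <;> simp [inbox, G.graph.adj_comm u v, hadj]

lemma WellFormed.communicate_of_mem {v : Fin n} (hv : v ∈ recolored G s t) :
    communicate (coloringAlgorithm n) G s v =
      ⟨v, sInf {c | 1 ≤ c ∧ ∀ u, G.graph.Adj v u → (s u).color ≠ c}, t, false⟩ := by
  have h₁ := (h.mayRecolor_iff hv.1).2 hv
  have h₂ : communicate (coloringAlgorithm n) G s v =
    (coloringAlgorithm n).receive (s v) (inbox G s v) := rfl
  rw [h₂]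
  simp only [if_pos h₁, h.id v hv.1, h.time v, h.reported_iff, not_exists, not_and, ne_eq]

lemma WellFormed.communicate_of_notMem {v : Fin n} (hv : v ∈ G.nodes)
    (hr : v ∉ recolored G s t) :
    (communicate (coloringAlgorithm n) G s v).id = v ∧
    (communicate (coloringAlgorithm n) G s v).color = (s v).color ∧
    ((communicate (coloringAlgorithm n) G s v).flag = true ↔ v ∈ needy G s) := by
  have h₁ := mt (h.mayRecolor_iff hv).1 hr
  have h₂ : communicate (coloringAlgorithm n) G s v =
    (coloringAlgorithm n).receive (s v) (inbox G s v) := rfl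
  rw [h₂]
  simp only [if_neg h₁, h.id v hv, h.reported_iff, decide_eq_true_eq, true_and]
  simp [needy, hv]

lemma WellFormed.communicate_id {v : Fin n} (hv : v ∈ G.nodes) :
    (communicate (coloringAlgorithm n) G s v).id = v := by
  by_cases hr : v ∈ recolored G s t
  · rw [h.communicate_of_mem hr]
  · exact (h.communicate_of_notMem hv hr).1

lemma WellFormed.flag_communicate {v : Fin n} (hv : v ∈ G.nodes) :
    (communicate (coloringAlgorithm n) G s v).flag = true ↔ v ∈ needy G s \ recolored G s t := by
  by_cases hr : v ∈ recolored G s t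
  · simp [h.communicate_of_mem hr, hr]
  · simp [(h.communicate_of_notMem hv hr).2.2, hr]

-- Pigeonhole: the neighbors of `v` cannot occupy `maxDegree + 1` colors.
omit h in
open Classical in
lemma exists_free_color (G : Network n) (s : Fin n → NodeState n) (v : Fin n) :
    ∃ c ≤ G.graph.maxDegree + 1, 1 ≤ c ∧ ∀ u, G.graph.Adj v u → (s u).color ≠ c := by
  by_contra! hc
  have hsub : Finset.Icc 1 (G.graph.maxDegree + 1) ⊆
      (G.graph.neighborFinset v).image fun u => (s u).color := by
    intro c hmem
    obtain ⟨u, hu, rfl⟩ := hc c (Finset.mem_Icc.1 hmem).2 (Finset.mem_Icc.1 hmem).1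
    exact Finset.mem_image_of_mem _ (by simpa using hu)
  have h₁ := (Finset.card_le_card hsub).trans Finset.card_image_le
  have h₂ := G.graph.degree_le_maxDegree v
  rw [SimpleGraph.card_neighborFinset_eq_degree, Nat.card_Icc] at h₁
  omega

omit h in
lemma free_color_spec (G : Network n) (s : Fin n → NodeState n) (v : Fin n) :
    1 ≤ sInf {c | 1 ≤ c ∧ ∀ u, G.graph.Adj v u → (s u).color ≠ c} ∧
      ∀ u, G.graph.Adj v u →
        (s u).color ≠ sInf {c | 1 ≤ c ∧ ∀ u, G.graph.Adj v u → (s u).color ≠ c} := by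
  obtain ⟨c, -, hc⟩ := exists_free_color G s v
  exact Nat.sInf_mem (s := {c | 1 ≤ c ∧ ∀ u, G.graph.Adj v u → (s u).color ≠ c}) ⟨c, hc⟩

open Classical in
lemma WellFormed.color_communicate_le {q : ℕ} (hq : G.graph.maxDegree + 1 ≤ q)
    (hs : ∀ v ∈ G.nodes, (s v).color ≤ q) {v : Fin n} (hv : v ∈ G.nodes) :
    (communicate (coloringAlgorithm n) G s v).color ≤ q := by
  by_cases hr : v ∈ recolored G s t
  · rw [h.communicate_of_mem hr]
    obtain ⟨c, hle, hc⟩ := exists_free_color G s v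
    exact (Nat.sInf_le hc).trans (hle.trans hq)
  · rw [(h.communicate_of_notMem hv hr).2.1]
    exact hs v hv

/-- A node that is not flagged at the end of a round is properly colored. -/
lemma WellFormed.proper_of_not_flag {v : Fin n} (hv : v ∈ G.nodes)
    (hf : v ∉ needy G s \ recolored G s t) :
    (communicate (coloringAlgorithm n) G s v).color ≠ 0 ∧ ∀ u, G.graph.Adj v u →
      (communicate (coloringAlgorithm n) G s u).color ≠
        (communicate (coloringAlgorithm n) G s v).color := by
  by_cases hr : v ∈ recolored G s t
  · obtain ⟨hpos, hfree⟩ := free_color_spec G s v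
    simp only [h.communicate_of_mem hr]
    refine ⟨by omega, fun u hu => ?_⟩
    -- Two adjacent recolored nodes would each have the smaller rank. So `u` keeps its old color,
    -- which the new color of `v` avoids.
    have hu' : u ∉ recolored G s t := fun hu' =>
      lt_asymm (hr.2.2 u hu hu'.2.1) (hu'.2.2 v hu.symm hr.2.1)
    rw [(h.communicate_of_notMem (h.closed u v hu.symm) hu').2.1]
    exact hfree u hu
  · have hn : v ∉ needy G s := fun hn => hf ⟨hn, hr⟩
    simp only [needy, Set.mem_ofPred_eq, hv, true_and, not_or, not_exists, not_and] at hn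
    rw [(h.communicate_of_notMem hv hr).2.1]
    refine ⟨hn.2.1, fun u hu => ?_⟩
    by_cases hu' : u ∈ recolored G s t
    · rw [h.communicate_of_mem hu']
      exact ((free_color_spec G s u).2 v hu.symm).symm
    · rw [(h.communicate_of_notMem (h.closed u v hu.symm) hu').2.1]
      exact hn.2.2 u hu

/-- Unflagged nodes end the round properly colored, and the flag is set on precisely the needy nodes
that were not recolored. In particular recoloring a node creates no new needy node. -/
lemma WellFormed.needy_communicate :
    needy G (communicate (coloringAlgorithm n) G s) = needy G s \ recolored G s t := by
  ext v
  constructor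
  · intro hv
    by_contra hf
    obtain ⟨h₀, hadj⟩ := h.proper_of_not_flag hv.1 hf
    rcases hv.2 with hfl | hc | ⟨u, hu, he⟩
    · exact hf ((h.flag_communicate hv.1).1 hfl)
    · exact h₀ hc
    · exact hadj u hu he
  · intro hv
    exact ⟨hv.1.1, Or.inl ((h.flag_communicate hv.1.1).2 hv)⟩

-- A flagged node of globally least rank beats all its flagged neighbors, because ranks are
-- distinct.
omit h in
lemma recolored_nonempty (hf : ∃ v ∈ G.nodes, (s v).flag = true) (hG : G.Closed) (t : ℕ) :
    (recolored G s t).Nonempty := by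
  obtain ⟨v, hv, hmin⟩ := Set.exists_min_image {v | v ∈ G.nodes ∧ (s v).flag = true} (rank t)
    (Set.toFinite _) hf
  refine ⟨v, hv.1, hv.2, fun u hu hfu => ?_⟩
  exact lt_of_le_of_ne (hmin u ⟨hG u v hu.symm, hfu⟩) fun he => hu.ne (rank_injective t he)

omit h in
lemma recolored_subset_needy : recolored G s t ⊆ needy G s := fun _ hv => ⟨hv.1, Or.inl hv.2.1⟩

end Communication

/-! ### The effect of topology changes -/

section Changes

variable {n : ℕ}

lemma Network.Closed.apply {G : Network n} (hG : G.Closed) {c : Change n} (hc : c.Legal G) :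
    (G.apply c).Closed := by
  intro a b hab
  cases c with
  | edgeInsert u v =>
    simp only [Network.apply, SimpleGraph.sup_adj, SimpleGraph.edge_adj] at hab ⊢
    rcases hab with hab | ⟨⟨rfl, rfl⟩ | ⟨rfl, rfl⟩, -⟩
    exacts [hG a b hab, hc.1, hc.2.1]
  | edgeDelete u v => exact hG a b (SimpleGraph.deleteEdges_le _ hab)
  | nodeInsert v N =>
    simp only [Network.apply, SimpleGraph.sup_adj, SimpleGraph.fromRel_adj] at hab ⊢
    rcases hab with hab | ⟨-, ⟨rfl, -⟩ | ⟨-, ha⟩⟩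
    exacts [Or.inr (hG a b hab), Or.inl rfl, Or.inr (hc.2 ha)]
  | nodeDelete v =>
    simp only [Network.apply, SimpleGraph.deleteEdges_adj] at hab ⊢
    refine ⟨hG a b hab.1, ?_⟩
    rintro rfl
    exact hab.2 ⟨hab.1, Sym2.mem_mk_left _ _⟩

/-- The nodes that may become needy by a change. -/
def Change.focus : Change n → Set (Fin n)
  | .edgeInsert u v => {u, v}
  | .edgeDelete _ _ => ∅
  | .nodeInsert v _ => {v}
  | .nodeDelete _ => ∅

lemma Change.ncard_focus_le (c : Change n) : c.focus.ncard ≤ 2 := by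
  cases c with
  | edgeInsert u v => exact (Set.ncard_insert_le _ _).trans (by simp)
  | _ => simp [Change.focus]

lemma needy_mono {G G' : Network n} {s : Fin n → NodeState n} (hn : G'.nodes ⊆ G.nodes)
    (hg : G'.graph ≤ G.graph) : needy G' s ⊆ needy G s := by
  rintro w ⟨hw, hf | hf | ⟨u, hu, he⟩⟩
  exacts [⟨hn hw, Or.inl hf⟩, ⟨hn hw, Or.inr (Or.inl hf)⟩,
    ⟨hn hw, Or.inr (Or.inr ⟨u, hg hu, he⟩)⟩]

/-- Deletions create no conflict, and a new edge affects only its two ends. An inserted node has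
color 0, so it can only conflict with nodes that were needy already, however many neighbors it has.
-/
lemma needy_apply_subset (G : Network n) (c : Change n)
    (L : Locals (coloringAlgorithm n)) :
    needy (G.apply c) (L.after G c).state ⊆ needy G L.state ∪ c.focus := by
  cases c with
  | edgeInsert u v =>
    have hs : (L.after G (.edgeInsert u v)).state = L.state := by simp [Locals.after]
    rw [hs]
    rintro w ⟨hw, hf | hf | ⟨x, hx, he⟩⟩
    · exact Or.inl ⟨hw, Or.inl hf⟩
    · exact Or.inl ⟨hw, Or.inr (Or.inl hf)⟩
    · simp only [Network.apply, SimpleGraph.sup_adj, SimpleGraph.edge_adj] at hx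
      rcases hx with hx | ⟨⟨rfl, rfl⟩ | ⟨rfl, rfl⟩, -⟩
      · exact Or.inl ⟨hw, Or.inr (Or.inr ⟨x, hx, he⟩)⟩
      · simp [Change.focus]
      · simp [Change.focus]
  | edgeDelete u v =>
    have hs : (L.after G (.edgeDelete u v)).state = L.state := by simp [Locals.after]
    rw [hs]
    exact fun w hw => Or.inl (needy_mono (G := G) (G' := G.apply (.edgeDelete u v)) subset_rfl
      (SimpleGraph.deleteEdges_le _) hw)
  | nodeInsert v N =>
    have hs : ∀ w, w ≠ v → (L.after G (.nodeInsert v N)).state w = L.state w := by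
      intro w hw
      simp [Locals.after, Ne.symm hw]
    have hv : (L.after G (.nodeInsert v N)).state v = ⟨v, 0, 0, true⟩ := by
      simp [Locals.after]
    rintro w ⟨hw, hneedy⟩
    by_cases hwv : w = v
    · exact Or.inr hwv
    have hw' : w ∈ G.nodes := hw.resolve_left hwv
    rw [hs w hwv] at hneedy
    refine Or.inl ⟨hw', ?_⟩
    rcases hneedy with hf | hf | ⟨x, hx, he⟩
    · exact Or.inl hf
    · exact Or.inr (Or.inl hf)
    · by_cases hxv : x = v
      -- A conflict with the new node forces `w` to have color 0, so `w` was needy before.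
      · subst hxv
        rw [hv] at he
        exact Or.inr (Or.inl he.symm)
      · rw [hs x hxv] at he
        simp only [Network.apply, SimpleGraph.sup_adj, SimpleGraph.fromRel_adj, hwv, hxv,
          false_and, or_false, and_false] at hx
        exact Or.inr (Or.inr ⟨x, hx, he⟩)
  | nodeDelete v =>
    have hs : (L.after G (.nodeDelete v)).state = L.state := by simp [Locals.after]
    rw [hs]
    exact fun w hw => Or.inl (needy_mono (G := G) (G' := G.apply (.nodeDelete v)) Set.sdiff_subset
      (SimpleGraph.deleteEdges_le _) hw)

lemma Network.Closed.applyAll {G : Network n} (hG : G.Closed) {cs : List (Change n)}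
    (hcs : G.LegalAll cs) : (G.applyAll cs).Closed := by
  induction cs generalizing G with
  | nil => exact hG
  | cons c cs ih => exact ih (hG.apply hcs.1) hcs.2

lemma ncard_needy_applyAll_le (G : Network n) (cs : List (Change n))
    (L : Locals (coloringAlgorithm n)) :
    (needy (G.applyAll cs) (L.afterAll G cs).state).ncard ≤
      (needy G L.state).ncard + 2 * cs.length := by
  induction cs generalizing G L with
  | nil => simp [Network.applyAll, Locals.afterAll]
  | cons c cs ih =>
    have h₁ := ih (G.apply c) (L.after G c)
    have h₂ := (Set.ncard_le_ncard (needy_apply_subset G c L)).trans (Set.ncard_union_le _ _)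
    have h₃ := c.ncard_focus_le
    have h₄ : (needy (G.applyAll (c :: cs)) (L.afterAll G (c :: cs)).state).ncard ≤
      (needy (G.apply c) (L.after G c).state).ncard + 2 * cs.length := h₁
    rw [List.length_cons]
    omega

/-- A property of states that holds for newly inserted nodes survives topology changes. -/
lemma forall_afterAll {A : Algorithm n} (P : Fin n → A.State → Prop) (hP : ∀ v, P v (A.join v))
    {G : Network n} {L : Locals A} (h : ∀ v ∈ G.nodes, P v (L.state v)) (cs : List (Change n)) :
    ∀ v ∈ (G.applyAll cs).nodes, P v ((L.afterAll G cs).state v) := by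
  induction cs generalizing G L with
  | nil => exact h
  | cons c cs ih =>
    refine ih fun v hv => ?_
    by_cases hc : ∃ N, c = .nodeInsert v N
    · simpa [Locals.after, hc] using hP v
    · simp only [Locals.after, hc, if_false]
      refine h v ?_
      cases c with
      | nodeInsert w N =>
        refine hv.resolve_left ?_
        rintro rfl
        exact hc ⟨N, rfl⟩
      | nodeDelete w => exact hv.1
      | edgeInsert u w => exact hv
      | edgeDelete u w => exact hv

lemma mem_nodes_applyAll {G : Network n} {cs : List (Change n)} {v : Fin n} (hv : v ∈ G.nodes)
    (hcs : ¬ TouchesAny G cs v) : v ∈ (G.applyAll cs).nodes := by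
  induction cs generalizing G with
  | nil => exact hv
  | cons c cs ih =>
    simp only [TouchesAny, not_or] at hcs
    refine ih ?_ hcs.2
    cases c with
    | nodeInsert w N => exact Or.inr hv
    | nodeDelete w =>
      refine ⟨hv, ?_⟩
      rintro rfl
      exact hcs.1 (Or.inr (Or.inr rfl))
    | edgeInsert u w => exact hv
    | edgeDelete u w => exact hv

end Changes

/-! ### Executions -/

section Execution

variable {n : ℕ} (D : DynamicNetwork n) (c₀ : Fin n → ℕ)

lemma DynamicNetwork.closed (i : ℕ) : (D.net i).Closed := by
  induction i with
  | zero => exact D.initial_edges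
  | succ i ih => exact ih.applyAll (D.legal i)

lemma DynamicNetwork.maxDegree_mono : Monotone D.maxDegree := fun i j hij =>
  Finset.sup_mono (by simpa using hij)

open Classical in
lemma DynamicNetwork.maxDegree_net_le (i : ℕ) : (D.net i).graph.maxDegree ≤ D.maxDegree i :=
  Finset.le_sup (f := fun j => (D.net j).graph.maxDegree) (by simp)

lemma DynamicNetwork.maxDegree_lt [Nonempty (Fin n)] (i : ℕ) : D.maxDegree i < n := by
  classical
  refine (Finset.sup_lt_iff (Fin.pos_iff_nonempty.2 ‹_›)).2 fun j _ => ?_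
  simpa using (D.net j).graph.maxDegree_lt_card_verts

/-- The states in round `i` before the communication. -/
noncomputable def stateBefore (i : ℕ) : Fin n → NodeState n :=
  (locals (coloringAlgorithm n) D c₀ i).updated (D.net i) i

/-- The states at the end of round `i`. -/
noncomputable def stateAfter (i : ℕ) : Fin n → NodeState n :=
  communicate (coloringAlgorithm n) (D.net i) (stateBefore D c₀ i)

lemma needy_stateBefore (i : ℕ) :
    needy (D.net i) (stateBefore D c₀ i) =
      needy (D.net i) (locals (coloringAlgorithm n) D c₀ i).state := rfl

variable {D c₀} (h₀ : Consistent (D.net 0) (D.maxDegree 0 + 1) c₀)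
include h₀

lemma locals_invariant (i : ℕ) : ∀ v ∈ (D.net i).nodes,
    ((locals (coloringAlgorithm n) D c₀ i).state v).id = v ∧
    ((locals (coloringAlgorithm n) D c₀ i).state v).color ≤ D.maxDegree i + 1 := by
  classical
  induction i with
  | zero => exact fun v hv => ⟨rfl, (h₀ v hv).2.1⟩
  | succ i ih =>
    refine forall_afterAll (A := coloringAlgorithm n)
      (fun v x => x.id = v ∧ x.color ≤ D.maxDegree (i + 1) + 1) (fun v => ⟨rfl, Nat.zero_le _⟩)
      (fun v hv => ?_) (D.changes i)
    have : Nonempty (Fin n) := ⟨v⟩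
    -- The induction hypothesis bounds colors by `maxDegree + 1 ≤ n`, so messages of this round are
    -- faithful and the analysis of the communication applies. The bound passes to the next round
    -- because the maximum is taken over all past rounds.
    have hwf : WellFormed (D.net i) (stateBefore D c₀ i) (i % (15 * n)) :=
      ⟨D.closed i, fun v hv => (ih v hv).1, fun _ => rfl,
        fun v hv => (ih v hv).2.trans (D.maxDegree_lt i)⟩
    refine ⟨hwf.communicate_id hv, ?_⟩
    exact (hwf.color_communicate_le (Nat.succ_le_succ (D.maxDegree_net_le i))
      (fun v hv => (ih v hv).2) hv).trans (Nat.succ_le_succ (D.maxDegree_mono i.le_succ))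

lemma wellFormed_stateBefore (i : ℕ) :
    WellFormed (D.net i) (stateBefore D c₀ i) (i % (15 * n)) := by
  refine ⟨D.closed i, fun v hv => (locals_invariant h₀ i v hv).1, fun _ => rfl, fun v hv => ?_⟩
  have : Nonempty (Fin n) := ⟨v⟩
  exact (locals_invariant h₀ i v hv).2.trans (D.maxDegree_lt i)

lemma color_stateAfter_le (i : ℕ) {v : Fin n} (hv : v ∈ (D.net i).nodes) :
    (stateAfter D c₀ i v).color ≤ D.maxDegree i + 1 := by
  classical
  exact (wellFormed_stateBefore h₀ i).color_communicate_le
    (Nat.succ_le_succ (D.maxDegree_net_le i)) (fun v hv => (locals_invariant h₀ i v hv).2) hv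

omit h₀ in
lemma starConsistent_of_notMem_needy {G : Network n} {q : ℕ} {s : Fin n → NodeState n}
    {v : Fin n} (hv : v ∈ G.nodes) (hq : (s v).color ≤ q) (hn : v ∉ needy G s) :
    StarConsistent G q (fun v => (s v).color) v := by
  simp only [needy, Set.mem_ofPred_eq, hv, true_and, not_or, not_exists, not_and] at hn
  exact ⟨Nat.one_le_iff_ne_zero.2 hn.2.1, hq, hn.2.2⟩

lemma flag_stateAfter_iff (i : ℕ) {v : Fin n} (hv : v ∈ (D.net i).nodes) :
    (stateAfter D c₀ i v).flag = true ↔ v ∈ needy (D.net i) (stateAfter D c₀ i) := by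
  have h := wellFormed_stateBefore h₀ i
  rw [stateAfter, h.needy_communicate, h.flag_communicate hv]

/-- Needy nodes only disappear during communication, so an inconsistency on either side of it shows
up in the needy set before it. -/
lemma needy_nonempty_of_incorrectRound {i : ℕ}
    (hi : IncorrectRound (coloringAlgorithm n) D c₀ i) :
    (needy (D.net i) (stateBefore D c₀ i)).Nonempty := by
  by_contra hne
  rw [Set.not_nonempty_iff_eq_empty] at hne
  have hne' : needy (D.net i) (stateAfter D c₀ i) = ∅ := by
    rw [stateAfter, (wellFormed_stateBefore h₀ i).needy_communicate, hne, Set.empty_sdiff]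
  rcases hi with hi | hi
  · exact hi fun v hv => starConsistent_of_notMem_needy hv (locals_invariant h₀ i v hv).2
      (s := stateBefore D c₀ i) (by simp [hne])
  · exact hi fun v hv => starConsistent_of_notMem_needy hv (color_stateAfter_le h₀ i hv)
      (s := stateAfter D c₀ i) (by simp [hne'])

lemma needy_stateBefore_zero : needy (D.net 0) (stateBefore D c₀ 0) = ∅ := by
  refine Set.eq_empty_of_forall_notMem ?_
  rintro v ⟨hv, hf | hf | ⟨u, hu, he⟩⟩
  · exact absurd hf Bool.false_ne_true
  · exact absurd (h₀ v hv).1 (by rw [show c₀ v = 0 from hf]; norm_num)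
  · exact (h₀ v hv).2.2 u hu he

/-- The potential argument for a single round. -/
lemma ncard_needy_succ (i : ℕ) [Decidable (IncorrectRound (coloringAlgorithm n) D c₀ (i + 1))] :
    (needy (D.net (i + 1)) (stateAfter D c₀ (i + 1))).ncard +
      (if IncorrectRound (coloringAlgorithm n) D c₀ (i + 1) then 1 else 0) ≤
      (needy (D.net i) (stateAfter D c₀ i)).ncard + 3 * (D.changes i).length := by
  have h := wellFormed_stateBefore h₀ (i + 1)
  have hbound : (needy (D.net (i + 1)) (stateBefore D c₀ (i + 1))).ncard ≤
      (needy (D.net i) (stateAfter D c₀ i)).ncard + 2 * (D.changes i).length :=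
    ncard_needy_applyAll_le (D.net i) (D.changes i) ⟨stateAfter D c₀ i, fun _ => ∅⟩
  have hdiff : needy (D.net (i + 1)) (stateAfter D c₀ (i + 1)) = _ := h.needy_communicate
  have hle : (needy (D.net (i + 1)) (stateAfter D c₀ (i + 1))).ncard ≤
      (needy (D.net (i + 1)) (stateBefore D c₀ (i + 1))).ncard := by
    rw [hdiff]
    exact Set.ncard_le_ncard Set.sdiff_subset
  split_ifs with hinc
  swap
  · omega
  -- If some change occurred, its third unit pays for the incorrect round. Otherwise the states are
  -- those at the end of the previous round, where needy means flagged, so some node is recolored.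
  rcases Nat.eq_zero_or_pos (D.changes i).length with hz | hpos
  swap
  · omega
  rw [List.length_eq_zero_iff] at hz
  have hnet : D.net (i + 1) = D.net i := by
    change (D.net i).applyAll (D.changes i) = _
    rw [hz]
    rfl
  have hloc : (locals (coloringAlgorithm n) D c₀ (i + 1)).state = stateAfter D c₀ i := by
    simp only [locals, hz, Locals.afterAll]
    rfl
  obtain ⟨v, hv⟩ := needy_nonempty_of_incorrectRound h₀ hinc
  have hflag : (stateBefore D c₀ (i + 1) v).flag = true := by
    rw [needy_stateBefore, hloc, hnet] at hv
    have hfl := (flag_stateAfter_iff h₀ i hv.1).2 hv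
    rw [← hloc] at hfl
    exact hfl
  obtain ⟨w, hw⟩ := recolored_nonempty ⟨v, hv.1, hflag⟩ h.closed ((i + 1) % (15 * n))
  have hlt : (needy (D.net (i + 1)) (stateAfter D c₀ (i + 1))).ncard <
      (needy (D.net (i + 1)) (stateBefore D c₀ (i + 1))).ncard := by
    refine Set.ncard_lt_ncard ?_
    rw [hdiff]
    exact ⟨Set.sdiff_subset, fun hsub => (hsub (recolored_subset_needy hw)).2 hw⟩
  omega

open Classical in
lemma ncard_needy_add_incorrect_le (i : ℕ) :
    (needy (D.net i) (stateAfter D c₀ i)).ncard +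
      ((Finset.range (i + 1)).filter (IncorrectRound (coloringAlgorithm n) D c₀)).card ≤
      3 * D.numChanges i := by
  induction i with
  | zero =>
    have h := (wellFormed_stateBefore h₀ 0).needy_communicate
    rw [needy_stateBefore_zero h₀, Set.empty_sdiff] at h
    have hc : ¬ IncorrectRound (coloringAlgorithm n) D c₀ 0 := fun hc => by
      have := needy_nonempty_of_incorrectRound h₀ hc
      rw [needy_stateBefore_zero h₀] at this
      exact Set.not_nonempty_empty this
    simp [stateAfter, h, hc, Finset.filter_singleton]
  | succ i ih =>
    have h₁ := ncard_needy_succ h₀ i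
    have h₂ : D.numChanges (i + 1) = D.numChanges i + (D.changes i).length :=
      Finset.sum_range_succ _ _
    have h₃ : ((Finset.range (i + 1 + 1)).filter
        (IncorrectRound (coloringAlgorithm n) D c₀)).card =
        ((Finset.range (i + 1)).filter (IncorrectRound (coloringAlgorithm n) D c₀)).card +
        (if IncorrectRound (coloringAlgorithm n) D c₀ (i + 1) then 1 else 0) := by
      rw [Finset.range_add_one (n := i + 1), Finset.filter_insert]
      split_ifs
      · rw [Finset.card_insert_of_notMem (by simp)]
      · rfl
    omega

theorem amortizedRounds_coloringAlgorithm :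
    AmortizedRounds (coloringAlgorithm n) D c₀ 3 := by
  classical
  intro i
  have h : {j | j ≤ i ∧ IncorrectRound (coloringAlgorithm n) D c₀ j} =
      ((Finset.range (i + 1)).filter (IncorrectRound (coloringAlgorithm n) D c₀) : Finset ℕ) := by
    ext j
    simp
  rw [numIncorrect, h, Set.ncard_coe_finset]
  exact (Nat.le_add_left _ _).trans (ncard_needy_add_incorrect_le h₀ i)

/-- A flagged node is recolored when its rank is zero. -/
lemma not_flag_stateAfter_of_rank_eq_zero {i : ℕ} {v : Fin n} (hv : v ∈ (D.net i).nodes)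
    (hf : (stateBefore D c₀ i v).flag = true) (hr : rank (i % (15 * n)) v = 0) :
    ¬ (stateAfter D c₀ i v).flag = true := by
  have h := wellFormed_stateBefore h₀ i
  rw [stateAfter, h.flag_communicate hv]
  refine fun hmem => hmem.2 ⟨hv, hf, fun u hu _ => ?_⟩
  refine lt_of_le_of_ne (hr ▸ rank_nonneg _ u) fun he => hu.ne (rank_injective _ he)

-- Inserted nodes start flagged, so the flag is set even if `v` was deleted and reinserted in
-- between.
omit h₀ in
lemma flag_stateBefore_succ {i : ℕ} {v : Fin n} (hf : (stateAfter D c₀ i v).flag = true)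
    (hv : v ∈ (D.net (i + 1)).nodes) : (stateBefore D c₀ (i + 1) v).flag = true :=
  forall_afterAll (A := coloringAlgorithm n) (fun w x => w = v → x.flag = true)
    (fun _ _ => rfl) (L := ⟨stateAfter D c₀ i, fun _ => ∅⟩) (fun _ _ hw => hw ▸ hf)
    (D.changes i) v hv rfl

theorem fixes_coloringAlgorithm : Fixes (coloringAlgorithm n) D c₀ := by
  intro i v hv hbad
  by_contra! hcon
  have hflag : ∀ j, v ∈ (D.net j).nodes →
      ¬ StarConsistent (D.net j) (D.maxDegree j + 1) (colorAfter (coloringAlgorithm n) D c₀ j) v →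
      (stateAfter D c₀ j v).flag = true := by
    intro j hj hbad
    by_contra hf
    rw [flag_stateAfter_iff h₀ j hj] at hf
    exact hbad (starConsistent_of_notMem_needy hj (color_stateAfter_le h₀ j hj) hf)
  have hmem : ∀ j ≥ i, v ∈ (D.net j).nodes := by
    intro j hj
    induction j, hj using Nat.le_induction with
    | base => exact hv
    | succ j hj ih => exact mem_nodes_applyAll ih (hcon j hj).1
  -- Round `v + (i + 1) * n` is a turn of `v` after round `i`. It is written as `j + 1` because the
  -- flag must be set at the end of the round before: a star still inconsistent in round `j` leaves
  -- `v` flagged, and the recoloring in round `j + 1` then clears the flag.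
  have hj : v + (i + 1) * n ≠ 0 := by have := v.pos; positivity
  obtain ⟨j, hj⟩ := Nat.exists_eq_succ_of_ne_zero hj
  have hij : i ≤ j := by
    have : (i + 1) * 1 ≤ (i + 1) * n := Nat.mul_le_mul_left _ v.pos
    omega
  have h₁ := hflag j (hmem j hij) (hcon j hij).2
  have h₂ := flag_stateBefore_succ h₁ (hmem (j + 1) (by omega))
  refine not_flag_stateAfter_of_rank_eq_zero h₀ (hmem (j + 1) (by omega)) h₂ ?_
    (hflag (j + 1) (hmem _ (by omega)) (hcon _ (by omega)).2)
  rw [← Nat.succ_eq_add_one, ← hj]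
  exact rank_eq_zero v (i + 1)

end Execution

end DynColoring

theorem mainTheorem6 :
    ∃ (A : (n : ℕ) → DynColoring.Algorithm n) (b k : ℕ), ∀ n : ℕ,
      (A n).MessagesAtMost (b * (Nat.log 2 n + 1)) ∧
      ∀ (D : DynColoring.DynamicNetwork n) (c₀ : Fin n → ℕ),
        DynColoring.Consistent (D.net 0) (D.maxDegree 0 + 1) c₀ →
          DynColoring.Fixes (A n) D c₀ ∧ DynColoring.AmortizedRounds (A n) D c₀ k :=
  ⟨DynColoring.coloringAlgorithm, 2, 3, fun n =>
    ⟨DynColoring.coloringAlgorithm_messagesAtMost n, fun _ _ h₀ =>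
      ⟨DynColoring.fixes_coloringAlgorithm h₀, DynColoring.amortizedRounds_coloringAlgorithm h₀⟩⟩⟩
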